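/- Let $\mathcal A$ and $\mathcal X$ be finite alphabets with $\mathcal X\neq\emptyset$, and let $B$ be a quantum system with finite-dimensional Hilbert space. An assemblage $\hat\rho=\{\hat\rho^{a,x}\}_{a\in\mathcal A,x\in\mathcal X}$ is a family of positive semidefinite operators on $B$ such that $\sum_a\hat\rho^{a,x}$ is a density operator that does not depend on $x$. Let $\mathrm{LHS}$ be the set of assemblages with a local-hidden-state model, that is, of the form $\hat\sigma^{a,x}=\sum_\lambda p(\lambda)\,p(a|x,\lambda)\,\sigma^\lambda$, where $\lambda$ ranges over a finite set, $p(\lambda)$ is a probability distribution, $p(a|x,\lambda)$ is a conditional probability distribution, and every $\sigma^\lambda$ is a density operator. Let $D(\rho\Vert\sigma)=\operatorname{Tr}(\rho[\log_2\rho-\log_2\sigma])$ if the support of $\rho$ is contained in the support of $\sigma$, and $D(\rho\Vert\sigma)=+\infty$ otherwise, where operator logarithms are taken on the support. The restricted relative entropy of steering of $\hat\rho$ is $$R_S^R(\hat\rho)=\sup_{p_X}\ \inf_{\hat\sigma\in\mathrm{LHS}} D\Big(\sum_{x,a}p_X(x)|x\rangle\langle x|\otimes|a\rangle\langle a|\otimes\hat\rho^{a,x}\,\Big\Vert\,\sum_{x,a}p_X(x)|x\rangle\langle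 x|\otimes|a\rangle\langle a|\otimes\hat\sigma^{a,x}\Big),$$ the supremum being over probability distributions $p_X$ on $\mathcal X$. Proposition. Let $\hat\rho$ be an assemblage. Then $R_S^R(\hat\rho)$ is a finite non-negative real number and $$\sqrt{2\ln 2\;R_S^R(\hat\rho)}\ \ge\ \inf_{\hat\sigma\in\mathrm{LHS}}\frac1{|\mathcal X|}\sum_{x,a}\big\Vert\hat\rho^{a,x}-\hat\sigma^{a,x}\big\Vert_1 ,$$ where $\Vert M\Vert_1=\operatorname{Tr}\sqrt{M^\dagger M}$. In particular, if $R_S^R(\hat\rho)=0$, then $\hat\rho\in\mathrm{LHS}$. -/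

import Mathlib

open scoped Kronecker ComplexOrder

namespace Steering

noncomputable section

/-- Density operators (quantum states) on the finite-dimensional Hilbert space `ℂ^n`. -/
def IsState {n : Type*} [Fintype n] (ρ : Matrix n n ℂ) : Prop :=
  ρ.PosSemidef ∧ ρ.trace = 1

/-- The trace norm `‖M‖₁ = Tr √(M† M)`. -/
def traceNorm {n : Type*} [Fintype n] [DecidableEq n] (M : Matrix n n ℂ) : ℝ :=
  (cfc Real.sqrt (M.conjTranspose * M)).trace.re

open scoped Classical in
/-- The quantum relative entropy `D(ρ‖σ) = Tr (ρ [log₂ ρ - log₂ σ])` if `supp ρ ⊆ supp σ`, and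
`+∞` otherwise. For positive semidefinite operators `supp ρ ⊆ supp σ` says `ker σ ⊆ ker ρ`.
Since `Real.logb 2 0 = 0`, the functional calculus gives the logarithm taken on the support and
extended by zero to the kernel. -/
def relEntropy {n : Type*} [Fintype n] [DecidableEq n] (ρ σ : Matrix n n ℂ) : EReal :=
  if ∀ v : n → ℂ, σ.mulVec v = 0 → ρ.mulVec v = 0 then
    (((ρ * (cfc (Real.logb 2) ρ - cfc (Real.logb 2) σ)).trace.re : ℝ) : EReal)
  else ⊤

variable {A X B : Type*} [Fintype A] [Fintype X] [Fintype B]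

/-- An assemblage `{ρ^{a,x}}`: positive semidefinite operators on Bob's system which satisfy the
no-signaling principle and for which the reduced operator `∑ₐ ρ^{a,x}` is a quantum state. -/
structure IsAssemblage (ρ : A → X → Matrix B B ℂ) : Prop where
  posSemidef : ∀ a x, (ρ a x).PosSemidef
  noSignaling : ∀ x x', ∑ a, ρ a x = ∑ a, ρ a x'
  isState : ∀ x, IsState (∑ a, ρ a x)

/-- The set of assemblages having a local-hidden-state model:
`ρ^{a,x} = ∑_l p(l) q(a|x,l) τ^l` with `p` a probability distribution, `q` a conditional
probability distribution and each `τ^l` a quantum state. -/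
def LHS (A X B : Type*) [Fintype A] [Fintype X] [Fintype B] : Set (A → X → Matrix B B ℂ) :=
  {ρ | IsAssemblage ρ ∧
    ∃ (m : ℕ) (p : Fin m → ℝ) (q : A → X → Fin m → ℝ) (τ : Fin m → Matrix B B ℂ),
      p ∈ stdSimplex ℝ (Fin m) ∧
      (∀ x l, (fun a => q a x l) ∈ stdSimplex ℝ A) ∧
      (∀ l, IsState (τ l)) ∧
      ∀ a x, ρ a x = ∑ l, (p l * q a x l) • τ l}

variable [DecidableEq A] [DecidableEq X]

/-- The classical-classical-quantum operator
`∑_{x,a} p(x) |x⟩⟨x| ⊗ |a⟩⟨a| ⊗ ρ^{a,x}`. -/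
def cqState (p : X → ℝ) (ρ : A → X → Matrix B B ℂ) : Matrix (X × A × B) (X × A × B) ℂ :=
  ∑ x, ∑ a, p x • (Matrix.single x x (1 : ℂ) ⊗ₖ (Matrix.single a a (1 : ℂ) ⊗ₖ ρ a x))

/-- The restricted relative entropy of steering: the supremum over probability distributions `p`
on the input alphabet of the infimum over `σ ∈ LHS` of the relative entropy between the two
classical-classical-quantum states. -/
def restrictedRelEntropy [DecidableEq B] (ρ : A → X → Matrix B B ℂ) : EReal :=
  ⨆ p ∈ stdSimplex ℝ X, ⨅ σ ∈ LHS A X B, relEntropy (cqState p ρ) (cqState p σ)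

end

end Steering

/-!
The heart of the matter is a quantum Pinsker inequality. For `P`, `Q` positive semidefinite with
eigenvalues `pᵢ`, `qⱼ` and orthonormal eigenvectors `uᵢ`, `wⱼ`, where `ker Q ⊆ ker P`, expanding in
the two eigenbases gives
`Tr K(P - Q) = ∑ᵢⱼ (pᵢ - qⱼ) ⟨uᵢ, wⱼ⟩ ⟨wⱼ, K uᵢ⟩` and
`Tr P(log P - log Q) - Tr P + Tr Q = ∑ᵢⱼ (pᵢ log (pᵢ / qⱼ) - pᵢ + qⱼ) |⟨uᵢ, wⱼ⟩|²`.
The scalar inequality `(r - s)² ≤ (2r/3 + 4s/3) (r log (r / s) - r + s)` and Cauchy–Schwarz bound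
the square of the first sum by `2 Tr P / 3 + 4 Tr Q / 3` times the second when `K` is unitary,
because the weights `|⟨wⱼ, K uᵢ⟩|²` form a doubly stochastic matrix; the sign of `P - Q` is a `K`
for which the first sum is the trace norm.

The trace norm of a classical-quantum operator is the weighted sum of those of its blocks, so
Pinsker's inequality with uniformly distributed inputs is the stated bound. The restricted relative
entropy is finite because `ρ^{a,x} ≤ |A| • σ^{a,x}` for the unsteerable assemblage `σ` with uniform
outcomes and hidden state `∑ₐ ρ^{a,x}`. Finally, every local-hidden-state model is a mixture of
deterministic strategies, so `LHS` is compact and an infimum equal to zero is attained.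
-/

namespace Steering

open Matrix InformationTheory
open scoped MatrixOrder

section ScalarPinsker

theorem convexOn_mul_klFun_sub_sq :
    ConvexOn ℝ (Set.Ici 0) fun t : ℝ => (2 * t + 4) * klFun t - 3 * (t - 1) ^ 2 := by
  have hd : ∀ t ∈ interior (Set.Ici (0 : ℝ)), HasDerivAt
      (fun t : ℝ => (2 * t + 4) * klFun t - 3 * (t - 1) ^ 2)
      (2 * klFun t + (2 * t + 4) * Real.log t - 6 * (t - 1)) t := fun t ht => by
    have ht : t ≠ 0 := (interior_Ici.subset ht : 0 < t).ne'
    refine ((((hasDerivAt_id t).const_mul 2).add_const 4).mul (hasDerivAt_klFun ht)).sub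
      ((((hasDerivAt_id t).sub_const 1).pow 2).const_mul 3) |>.congr_deriv ?_
    simp
    ring
  have hd' : ∀ t ∈ interior (Set.Ici (0 : ℝ)), HasDerivAt
      (fun t : ℝ => 2 * klFun t + (2 * t + 4) * Real.log t - 6 * (t - 1))
      (4 * (Real.log t - (1 - t⁻¹))) t := fun t ht => by
    have ht : t ≠ 0 := (interior_Ici.subset ht : 0 < t).ne'
    refine (((hasDerivAt_klFun ht).const_mul 2).add
      ((((hasDerivAt_id t).const_mul 2).add_const 4).mul (Real.hasDerivAt_log ht))).sub
      (((hasDerivAt_id t).sub_const 1).const_mul 6) |>.congr_deriv ?_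
    simp
    field_simp
    ring
  refine convexOn_of_hasDerivWithinAt2_nonneg (convex_Ici 0) ?_
    (fun t ht => (hd t ht).hasDerivWithinAt) (fun t ht => (hd' t ht).hasDerivWithinAt) ?_
  · have := continuous_klFun
    fun_prop
  · intro t ht
    have := Real.one_sub_inv_le_log_of_pos (interior_Ici.subset ht : 0 < t)
    linarith

theorem three_mul_sq_sub_one_le_mul_klFun {t : ℝ} (ht : 0 ≤ t) :
    3 * (t - 1) ^ 2 ≤ (2 * t + 4) * klFun t := by
  have hderiv : HasDerivAt (fun t : ℝ => (2 * t + 4) * klFun t - 3 * (t - 1) ^ 2) 0 1 := by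
    refine ((((hasDerivAt_id (1 : ℝ)).const_mul 2).add_const 4).mul
      (hasDerivAt_klFun one_ne_zero)).sub
      ((((hasDerivAt_id (1 : ℝ)).sub_const 1).pow 2).const_mul 3) |>.congr_deriv ?_
    simp [klFun_one]
  have hmin := convexOn_mul_klFun_sub_sq.isMinOn_of_rightDeriv_eq_zero (x := 1) (by simp)
    (hderiv.hasDerivWithinAt.derivWithin (uniqueDiffWithinAt_Ioi 1)) ht
  simpa [klFun_one] using hmin

/-- The scalar Bregman divergence `r log (r / s) - r + s` of `x ↦ x log x`. It is meaningful for
`0 ≤ r` and `0 < s`; at `s = 0` it has the junk value `r log r - r`. -/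
noncomputable def scalarKL (r s : ℝ) : ℝ :=
  r * (Real.log r - Real.log s) - r + s

theorem scalarKL_eq_mul_klFun {r s : ℝ} (h : s = 0 → r = 0) :
    scalarKL r s = s * klFun (r / s) := by
  rcases eq_or_ne r 0 with rfl | hr
  · simp [scalarKL, klFun_zero]
  · have hs : s ≠ 0 := mt h hr
    rw [scalarKL, klFun_apply, Real.log_div hr hs]
    field_simp
    ring

theorem scalarKL_nonneg {r s : ℝ} (hr : 0 ≤ r) (hs : 0 ≤ s) (h : s = 0 → r = 0) :
    0 ≤ scalarKL r s := by
  rw [scalarKL_eq_mul_klFun h]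
  exact mul_nonneg hs (klFun_nonneg (by positivity))

theorem sq_sub_le_mul_scalarKL {r s : ℝ} (hr : 0 ≤ r) (hs : 0 ≤ s) (h : s = 0 → r = 0) :
    (r - s) ^ 2 ≤ (2 / 3 * r + 4 / 3 * s) * scalarKL r s := by
  obtain ⟨t, ht, rfl⟩ : ∃ t, 0 ≤ t ∧ r = s * t :=
    ⟨r / s, by positivity, (mul_div_cancel_of_imp' h).symm⟩
  rcases hs.eq_or_lt with rfl | hs
  · simp
  have hscaled := mul_le_mul_of_nonneg_left (three_mul_sq_sub_one_le_mul_klFun ht) (sq_nonneg s)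
  rw [scalarKL_eq_mul_klFun h, mul_div_cancel_left₀ t hs.ne']
  linarith

end ScalarPinsker

section Spectral

variable {n : Type*} [Fintype n] [DecidableEq n] {P Q : Matrix n n ℂ}

theorem cfc_eq_eigenvectorUnitary_mul (hP : P.IsHermitian) (f : ℝ → ℝ) :
    cfc f P = (hP.eigenvectorUnitary : Matrix n n ℂ) *
      diagonal (fun i => (f (hP.eigenvalues i) : ℂ)) *
        star (hP.eigenvectorUnitary : Matrix n n ℂ) := by
  rw [hP.cfc_eq, IsHermitian.cfc, Unitary.conjStarAlgAut_apply]
  rfl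

theorem cfc_id_eq (hP : P.IsHermitian) : cfc (fun x : ℝ => x) P = P :=
  cfc_id' ℝ P hP.isSelfAdjoint

theorem continuousOn_spectrum (P : Matrix n n ℂ) (f : ℝ → ℝ) : ContinuousOn f (spectrum ℝ P) :=
  P.finite_real_spectrum.continuousOn f

theorem trace_cfc (hP : P.IsHermitian) (f : ℝ → ℝ) :
    (cfc f P).trace = ∑ i, (f (hP.eigenvalues i) : ℂ) := by
  rw [cfc_eq_eigenvectorUnitary_mul hP, trace_mul_comm, ← Matrix.mul_assoc,
    Unitary.coe_star_mul_self, Matrix.one_mul, trace_diagonal]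

/-- The unitary matrix `(⟨uᵢ, wⱼ⟩)ᵢⱼ` of inner products between the eigenvectors `uᵢ` of `P` and
`wⱼ` of `Q`. -/
noncomputable def overlap (hP : P.IsHermitian) (hQ : Q.IsHermitian) : unitaryGroup n ℂ :=
  star hP.eigenvectorUnitary * hQ.eigenvectorUnitary

theorem sum_sq_norm_row (V : unitaryGroup n ℂ) (i : n) : ∑ j, ‖V i j‖ ^ 2 = 1 := by
  have h := congrFun (congrFun (Unitary.coe_mul_star_self V) i) i
  simp only [mul_apply, Unitary.coe_star, star_apply, one_apply_eq, RCLike.star_def,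
    Complex.mul_conj, Complex.normSq_eq_norm_sq] at h
  exact_mod_cast h

theorem sum_sq_norm_col (V : unitaryGroup n ℂ) (j : n) : ∑ i, ‖V i j‖ ^ 2 = 1 := by
  simpa using sum_sq_norm_row (star V) j

theorem trace_mul_cfc_mul_cfc (hP : P.IsHermitian) (hQ : Q.IsHermitian) (K : Matrix n n ℂ)
    (f g : ℝ → ℝ) :
    (K * cfc f P * cfc g Q).trace = ∑ i, ∑ j,
      (f (hP.eigenvalues i) * g (hQ.eigenvalues j) : ℂ) * (overlap hP hQ i j *
        (star (hQ.eigenvectorUnitary : Matrix n n ℂ) * K * hP.eigenvectorUnitary) j i) := by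
  set U := (hP.eigenvectorUnitary : Matrix n n ℂ)
  set W := (hQ.eigenvectorUnitary : Matrix n n ℂ)
  set a : n → ℂ := fun i => f (hP.eigenvalues i)
  set b : n → ℂ := fun j => g (hQ.eigenvalues j)
  calc (K * cfc f P * cfc g Q).trace
      = ((K * U) * (diagonal a * (star U * W) * diagonal b * star W)).trace := by
        simp only [cfc_eq_eigenvectorUnitary_mul hP, cfc_eq_eigenvectorUnitary_mul hQ,
          Matrix.mul_assoc, U, W, a, b]
    _ = ((diagonal a * (star U * W) * diagonal b) * (star W * K * U)).trace := by
        rw [trace_mul_comm]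
        simp only [Matrix.mul_assoc]
    _ = ∑ i, ∑ j, a i * b j * ((star U * W) i j * (star W * K * U) j i) := by
        simp only [trace, diag, mul_apply (M := _ * diagonal b), mul_diagonal, diagonal_mul]
        exact Finset.sum_congr rfl fun i _ => Finset.sum_congr rfl fun j _ => by ring

theorem trace_cfc_mul_cfc (hP : P.IsHermitian) (hQ : Q.IsHermitian) (f g : ℝ → ℝ) :
    (cfc f P * cfc g Q).trace = ((∑ i, ∑ j,
      f (hP.eigenvalues i) * g (hQ.eigenvalues j) * ‖overlap hP hQ i j‖ ^ 2 : ℝ) : ℂ) := by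
  have h := trace_mul_cfc_mul_cfc hP hQ 1 f g
  have hstar : star (hQ.eigenvectorUnitary : Matrix n n ℂ) * 1 * hP.eigenvectorUnitary =
      star (overlap hP hQ : Matrix n n ℂ) := by
    simp [overlap]
  rw [Matrix.one_mul, hstar] at h
  simp only [h, star_apply, RCLike.star_def, Complex.mul_conj, Complex.normSq_eq_norm_sq]
  push_cast
  rfl

theorem eigenvalues_eq_zero_of_overlap_ne_zero (hP : P.IsHermitian) (hQ : Q.IsHermitian)
    (hker : ∀ v, Q *ᵥ v = 0 → P *ᵥ v = 0) {i j : n} (hij : overlap hP hQ i j ≠ 0)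
    (hj : hQ.eigenvalues j = 0) : hP.eigenvalues i = 0 := by
  set U := (hP.eigenvectorUnitary : Matrix n n ℂ)
  set W := (hQ.eigenvectorUnitary : Matrix n n ℂ)
  have hw : P *ᵥ W.col j = 0 := hker _ <| by
    simp [W, hQ.eigenvectorUnitary_col_eq, hQ.mulVec_eigenvectorBasis, hj]
  have hUP : star U * P = diagonal (fun i => (hP.eigenvalues i : ℂ)) * star U := by
    conv_lhs => rw [← cfc_id_eq hP, cfc_eq_eigenvectorUnitary_mul hP]
    rw [← Matrix.mul_assoc, ← Matrix.mul_assoc, Unitary.coe_star_mul_self, Matrix.one_mul]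
  have hzero : (star U *ᵥ (P *ᵥ W.col j)) i = 0 := by simp [hw]
  rw [mulVec_mulVec, hUP, ← mulVec_mulVec, mulVec_diagonal] at hzero
  exact_mod_cast (mul_eq_zero.mp hzero).resolve_right hij

theorem re_trace_mul_log_sub_log (hP : P.IsHermitian) (hQ : Q.IsHermitian) :
    (P * (cfc Real.log P - cfc Real.log Q)).trace.re - P.trace.re + Q.trace.re =
      ∑ i, ∑ j, scalarKL (hP.eigenvalues i) (hQ.eigenvalues j) * ‖overlap hP hQ i j‖ ^ 2 := by
  have hPlogP : P * cfc Real.log P =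
      cfc (fun x : ℝ => x * Real.log x) P * cfc (fun _ : ℝ => (1 : ℝ)) Q := by
    rw [cfc_mul (fun x : ℝ => x) Real.log P (continuousOn_spectrum _ _) (continuousOn_spectrum _ _),
      cfc_id_eq hP, cfc_const_one ℝ Q, Matrix.mul_one]
  have hPlogQ : P * cfc Real.log Q = cfc (fun x : ℝ => x) P * cfc Real.log Q := by
    rw [cfc_id_eq hP]
  have hPone : P = cfc (fun x : ℝ => x) P * cfc (fun _ : ℝ => (1 : ℝ)) Q := by
    rw [cfc_id_eq hP, cfc_const_one ℝ Q, Matrix.mul_one]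
  have hQone : Q = cfc (fun _ : ℝ => (1 : ℝ)) P * cfc (fun x : ℝ => x) Q := by
    rw [cfc_id_eq hQ, cfc_const_one ℝ P, Matrix.one_mul]
  rw [Matrix.mul_sub, trace_sub, Complex.sub_re, hPlogP, hPlogQ, trace_cfc_mul_cfc hP hQ,
    trace_cfc_mul_cfc hP hQ, congrArg trace hPone, congrArg trace hQone, trace_cfc_mul_cfc hP hQ,
    trace_cfc_mul_cfc hP hQ]
  simp only [Complex.ofReal_re, ← Finset.sum_sub_distrib, ← Finset.sum_add_distrib, scalarKL]
  exact Finset.sum_congr rfl fun i _ => Finset.sum_congr rfl fun j _ => by ring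

end Spectral

section Pinsker

variable {n : Type*} [Fintype n] [DecidableEq n] {P Q M : Matrix n n ℂ}

theorem sum_add_mul_sq_norm (C : unitaryGroup n ℂ) (a b : n → ℝ) :
    ∑ i, ∑ j, (a i + b j) * ‖C j i‖ ^ 2 = ∑ i, a i + ∑ j, b j := by
  simp only [add_mul, Finset.sum_add_distrib]
  congr 1
  · simp only [← Finset.mul_sum, sum_sq_norm_col, mul_one]
  · rw [Finset.sum_comm]
    simp only [← Finset.mul_sum, sum_sq_norm_row, mul_one]

theorem trace_mul_sub_eq_sum (hP : P.IsHermitian) (hQ : Q.IsHermitian) (K : unitaryGroup n ℂ) :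
    ((K : Matrix n n ℂ) * (P - Q)).trace =
      ∑ i, ∑ j, ((hP.eigenvalues i - hQ.eigenvalues j : ℝ) : ℂ) * (overlap hP hQ i j *
        (star hQ.eigenvectorUnitary * K * hP.eigenvectorUnitary : unitaryGroup n ℂ) j i) := by
  have hKP := trace_mul_cfc_mul_cfc hP hQ K (fun x => x) fun _ => 1
  have hKQ := trace_mul_cfc_mul_cfc hP hQ K (fun _ => 1) fun x => x
  rw [cfc_id_eq hP, cfc_const_one ℝ Q, Matrix.mul_one] at hKP
  rw [cfc_id_eq hQ, cfc_const_one ℝ P, Matrix.mul_one] at hKQ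
  rw [Matrix.mul_sub, trace_sub, hKP, hKQ]
  simp only [← Finset.sum_sub_distrib, Unitary.coe_star, Submonoid.coe_mul]
  refine Finset.sum_congr rfl fun i _ => Finset.sum_congr rfl fun j _ => ?_
  push_cast
  ring

theorem norm_trace_mul_sub_le (hP : P.IsHermitian) (hQ : Q.IsHermitian) (K : unitaryGroup n ℂ) :
    ‖((K : Matrix n n ℂ) * (P - Q)).trace‖ ≤
      ∑ i, ∑ j, |hP.eigenvalues i - hQ.eigenvalues j| * (‖overlap hP hQ i j‖ *
        ‖(star hQ.eigenvectorUnitary * K * hP.eigenvectorUnitary : unitaryGroup n ℂ) j i‖) := by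
  rw [trace_mul_sub_eq_sum hP hQ]
  refine (norm_sum_le _ _).trans (Finset.sum_le_sum fun i _ => ?_)
  refine (norm_sum_le _ _).trans_eq (Finset.sum_congr rfl fun j _ => ?_)
  rw [norm_mul, norm_mul, Complex.norm_real, Real.norm_eq_abs]

theorem sq_norm_trace_mul_sub_le (hP : P.PosSemidef) (hQ : Q.PosSemidef)
    (hker : ∀ v, Q *ᵥ v = 0 → P *ᵥ v = 0) (K : unitaryGroup n ℂ) :
    ‖((K : Matrix n n ℂ) * (P - Q)).trace‖ ^ 2 ≤
      (2 / 3 * P.trace.re + 4 / 3 * Q.trace.re) *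
        ((P * (cfc Real.log P - cfc Real.log Q)).trace.re - P.trace.re + Q.trace.re) := by
  have hPh := hP.isHermitian
  have hQh := hQ.isHermitian
  set p := hPh.eigenvalues
  set q := hQh.eigenvalues
  have hp : ∀ i, 0 ≤ p i := hP.eigenvalues_nonneg
  have hq : ∀ j, 0 ≤ q j := hQ.eigenvalues_nonneg
  set V := overlap hPh hQh
  set C := (star hQh.eigenvectorUnitary * K * hPh.eigenvectorUnitary : unitaryGroup n ℂ)
  have hzero : ∀ i j, V i j ≠ 0 → q j = 0 → p i = 0 := fun i j =>
    eigenvalues_eq_zero_of_overlap_ne_zero hPh hQh hker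
  have hweight : 2 / 3 * P.trace.re + 4 / 3 * Q.trace.re =
      ∑ i, ∑ j, (2 / 3 * p i + 4 / 3 * q j) * ‖C j i‖ ^ 2 := by
    rw [sum_add_mul_sq_norm, ← Finset.mul_sum, ← Finset.mul_sum, hPh.trace_eq_sum_eigenvalues,
      hQh.trace_eq_sum_eigenvalues]
    simp [p, q]
  refine (pow_le_pow_left₀ (norm_nonneg _) (norm_trace_mul_sub_le hPh hQh K) 2).trans ?_
  rw [hweight, re_trace_mul_log_sub_log hPh hQh]
  simp only [← Fintype.sum_prod_type']
  refine Finset.sum_sq_le_sum_mul_sum_of_sq_le_mul _ (fun ⟨i, j⟩ _ => ?_) (fun ⟨i, j⟩ _ => ?_)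
    fun ⟨i, j⟩ _ => ?_ <;> dsimp only
  · have := hp i
    have := hq j
    positivity
  all_goals
    rcases eq_or_ne (V i j) 0 with hV | hV
    · simp [hV, V]
  · exact mul_nonneg (scalarKL_nonneg (hp i) (hq j) (hzero i j hV)) (sq_nonneg _)
  · have h := mul_le_mul_of_nonneg_left (sq_sub_le_mul_scalarKL (hp i) (hq j) (hzero i j hV))
      (sq_nonneg (‖V i j‖ * ‖C j i‖))
    rw [mul_pow, sq_abs]
    linarith

theorem traceNorm_eq_re_trace_abs (M : Matrix n n ℂ) : traceNorm M = (CFC.abs M).trace.re := by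
  rw [traceNorm, CFC.abs, CFC.sqrt_eq_real_sqrt _ (star_mul_self_nonneg M), cfcₙ_eq_cfc]
  rfl

theorem exists_unitary_re_trace_mul_eq_traceNorm (hM : M.IsHermitian) :
    ∃ K : unitaryGroup n ℂ, ((K : Matrix n n ℂ) * M).trace.re = traceNorm M := by
  let phase : ℝ → ℝ := fun x => if 0 ≤ x then 1 else -1
  have hphase : cfc phase M ∈ unitaryGroup n ℂ :=
    (cfc_unitary_iff phase M hM.isSelfAdjoint (continuousOn_spectrum M phase)).mpr fun x _ => by
      by_cases hx : 0 ≤ x <;> simp [phase, hx]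
  refine ⟨⟨_, hphase⟩, ?_⟩
  calc (cfc phase M * M).trace.re
      = (cfc phase M * cfc (fun x : ℝ => x) M).trace.re := by rw [cfc_id_eq hM]
    _ = (cfc (fun x : ℝ => ‖x‖) M).trace.re := by
        rw [← cfc_mul _ _ _ (continuousOn_spectrum _ _) (continuousOn_spectrum _ _)]
        congr! 4 with x
        by_cases hx : 0 ≤ x
        · simp [phase, hx, abs_of_nonneg hx]
        · simp [phase, hx, abs_of_neg (not_le.mp hx)]
    _ = traceNorm M := by
        rw [traceNorm_eq_re_trace_abs, CFC.abs_eq_cfc_norm M hM.isSelfAdjoint]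

theorem sq_traceNorm_sub_le (hP : P.PosSemidef) (hQ : Q.PosSemidef)
    (hker : ∀ v, Q *ᵥ v = 0 → P *ᵥ v = 0) :
    traceNorm (P - Q) ^ 2 ≤ (2 / 3 * P.trace.re + 4 / 3 * Q.trace.re) *
      ((P * (cfc Real.log P - cfc Real.log Q)).trace.re - P.trace.re + Q.trace.re) := by
  obtain ⟨K, hK⟩ :=
    exists_unitary_re_trace_mul_eq_traceNorm (hP.isHermitian.sub hQ.isHermitian)
  rw [← hK]
  exact (sq_le_sq.mpr ((Complex.abs_re_le_norm _).trans (le_abs_self _))).trans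
    (sq_norm_trace_mul_sub_le hP hQ hker K)

theorem cfc_logb (M : Matrix n n ℂ) (b : ℝ) :
    cfc (Real.logb b) M = (Real.log b)⁻¹ • cfc Real.log M := by
  rw [← cfc_smul _ _ _ (continuousOn_spectrum _ _)]
  congr! 2 with x
  rw [smul_eq_mul, Real.logb, div_eq_inv_mul]

theorem relEntropy_of_ker_le (hker : ∀ v, Q *ᵥ v = 0 → P *ᵥ v = 0) :
    relEntropy P Q =
      (((P * (cfc Real.log P - cfc Real.log Q)).trace.re / Real.log 2 : ℝ) : EReal) := by
  rw [relEntropy, if_pos hker, cfc_logb, cfc_logb, ← smul_sub, Matrix.mul_smul, trace_smul,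
    Complex.smul_re, smul_eq_mul, div_eq_inv_mul]

theorem sq_traceNorm_sub_le_relEntropy {ρ σ : Matrix n n ℂ} (hρ : IsState ρ) (hσ : IsState σ) :
    ((traceNorm (ρ - σ) ^ 2 / (2 * Real.log 2) : ℝ) : EReal) ≤ relEntropy ρ σ := by
  by_cases hker : ∀ v, σ *ᵥ v = 0 → ρ *ᵥ v = 0
  · have h := sq_traceNorm_sub_le hρ.1 hσ.1 hker
    rw [hρ.2, hσ.2, Complex.one_re] at h
    have := Real.log_pos one_lt_two
    rw [relEntropy_of_ker_le hker, EReal.coe_le_coe_iff]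
    field_simp
    linarith
  · rw [relEntropy, if_neg hker]
    exact le_top

theorem relEntropy_nonneg {ρ σ : Matrix n n ℂ} (hρ : IsState ρ) (hσ : IsState σ) :
    0 ≤ relEntropy ρ σ := by
  have := Real.log_pos one_lt_two
  refine le_trans ?_ (sq_traceNorm_sub_le_relEntropy hρ hσ)
  exact_mod_cast (by positivity : 0 ≤ traceNorm (ρ - σ) ^ 2 / (2 * Real.log 2))

end Pinsker

section TraceNorm

variable {n : Type*} [Fintype n] [DecidableEq n] {P M : Matrix n n ℂ}

open scoped Matrix.Norms.L2Operator

theorem eigenvalues_le_re_trace (hP : P.PosSemidef) (i : n) :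
    hP.isHermitian.eigenvalues i ≤ P.trace.re := by
  simpa [hP.isHermitian.trace_eq_sum_eigenvalues] using
    Finset.single_le_sum (fun j _ => hP.eigenvalues_nonneg j) (Finset.mem_univ i)

theorem norm_le_re_trace (hP : P.PosSemidef) : ‖P‖ ≤ P.trace.re := by
  nth_rw 1 [← cfc_id_eq hP.isHermitian]
  refine norm_cfc_le (Complex.nonneg_iff.mp hP.trace_nonneg).1 fun x hx => ?_
  obtain ⟨i, rfl⟩ := hP.isHermitian.spectrum_real_eq_range_eigenvalues ▸ hx
  simpa [abs_of_nonneg (hP.eigenvalues_nonneg i)] using eigenvalues_le_re_trace hP i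

theorem norm_le_traceNorm (M : Matrix n n ℂ) : ‖M‖ ≤ traceNorm M := by
  rw [traceNorm_eq_re_trace_abs, ← CFC.norm_abs]
  exact norm_le_re_trace (CFC.abs_nonneg M).posSemidef

theorem traceNorm_nonneg (M : Matrix n n ℂ) : 0 ≤ traceNorm M :=
  (norm_nonneg M).trans (norm_le_traceNorm M)

end TraceNorm

section Domination

variable {n : Type*} [Fintype n]

theorem trace_mul_nonneg {P Q : Matrix n n ℂ} (hP : P.PosSemidef) (hQ : Q.PosSemidef) :
    0 ≤ (P * Q).trace := by
  classical
  obtain ⟨R, rfl⟩ := CStarAlgebra.nonneg_iff_eq_star_mul_self.mp hQ.nonneg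
  rw [star_eq_conjTranspose, ← Matrix.mul_assoc, trace_mul_comm, ← Matrix.mul_assoc]
  exact (hP.mul_mul_conjTranspose_same R).trace_nonneg

theorem mulVec_eq_zero_of_le {P Q : Matrix n n ℂ} (hP : P.PosSemidef) (h : P ≤ Q) {v : n → ℂ}
    (hv : Q *ᵥ v = 0) : P *ᵥ v = 0 := by
  have hle := (le_iff.mp h).dotProduct_mulVec_nonneg v
  rw [sub_mulVec, hv, zero_sub, dotProduct_neg, Left.nonneg_neg_iff] at hle
  exact (hP.dotProduct_mulVec_zero_iff v).mp (hle.antisymm (hP.dotProduct_mulVec_nonneg v))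

variable [DecidableEq n] {ρ σ : Matrix n n ℂ}

theorem IsState.cfc_neg_log_posSemidef (hρ : IsState ρ) :
    (cfc (fun x => -Real.log x) ρ).PosSemidef :=
  (cfc_nonneg fun x hx => by
    obtain ⟨i, rfl⟩ := hρ.1.isHermitian.spectrum_real_eq_range_eigenvalues ▸ hx
    exact neg_nonneg.mpr <| Real.log_nonpos (hρ.1.eigenvalues_nonneg i) <|
      (eigenvalues_le_re_trace hρ.1 i).trans_eq (by rw [hρ.2, Complex.one_re])).posSemidef

theorem IsState.re_trace_mul_log_nonpos (hρ : IsState ρ) :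
    (ρ * cfc Real.log ρ).trace.re ≤ 0 := by
  simpa [cfc_neg] using (Complex.nonneg_iff.mp (trace_mul_nonneg hρ.1 hρ.cfc_neg_log_posSemidef)).1

theorem re_trace_mul_neg_log_le_card (hρ : ρ.PosSemidef) :
    (ρ * cfc (fun x => -Real.log x) ρ).trace.re ≤ Fintype.card n := by
  have hmul : ρ * cfc (fun x => -Real.log x) ρ = cfc Real.negMulLog ρ := by
    nth_rw 1 [← cfc_id_eq hρ.isHermitian]
    rw [← cfc_mul _ _ _ (continuousOn_spectrum _ _) (continuousOn_spectrum _ _)]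
    simp [Real.negMulLog_def]
  rw [hmul, trace_cfc hρ.isHermitian]
  calc (∑ i, (Real.negMulLog (hρ.isHermitian.eigenvalues i) : ℂ)).re
      = ∑ i, Real.negMulLog (hρ.isHermitian.eigenvalues i) := by simp
    _ ≤ ∑ _ : n, 1 := Finset.sum_le_sum fun i _ =>
        (Real.negMulLog_le_one_sub_self (hρ.eigenvalues_nonneg i)).trans
          (sub_le_self _ (hρ.eigenvalues_nonneg i))
    _ = Fintype.card n := by simp

theorem relEntropy_le_of_le_smul (hρ : IsState ρ) (hσ : IsState σ) {c : ℝ} (hc : 0 ≤ c)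
    (h : ρ ≤ c • σ) :
    relEntropy ρ σ ≤ ((c * Fintype.card n / Real.log 2 : ℝ) : EReal) := by
  have hlog := (Complex.nonneg_iff.mp (trace_mul_nonneg (le_iff.mp h) hσ.cfc_neg_log_posSemidef)).1
  have hρlog := hρ.re_trace_mul_log_nonpos
  have hσlog := mul_le_mul_of_nonneg_left (re_trace_mul_neg_log_le_card hσ.1) hc
  rw [relEntropy_of_ker_le fun v hv => mulVec_eq_zero_of_le hρ.1 h (by
    rw [smul_mulVec, hv, smul_zero]), EReal.coe_le_coe_iff]
  refine div_le_div_of_nonneg_right ?_ (Real.log_nonneg one_le_two)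
  simp only [cfc_neg, Matrix.mul_sub, Matrix.sub_mul, Matrix.mul_neg, trace_sub, trace_neg,
    smul_mul, trace_smul, Complex.sub_re, Complex.neg_re, Complex.smul_re, smul_eq_mul] at *
  linarith

end Domination

section CQState

variable {A X B : Type*} [Fintype A] [Fintype X] [DecidableEq A] [DecidableEq X]
  {p : X → ℝ} {ρ σ : A → X → Matrix B B ℂ}

theorem cqState_apply (p : X → ℝ) (ρ : A → X → Matrix B B ℂ) (x x' : X) (a a' : A) (b b' : B) :
    cqState p ρ (x, a, b) (x', a', b') =
      if x = x' ∧ a = a' then (p x : ℂ) * ρ a x b b' else 0 := by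
  simp only [cqState, Matrix.sum_apply, Matrix.smul_apply, kroneckerMap_apply, single_apply]
  rw [Finset.sum_eq_single x (fun y _ hy => by simp [hy]) (by simp),
    Finset.sum_eq_single a (fun y _ hy => by simp [hy]) (by simp)]
  split_ifs <;> simp_all

theorem cqState_sub (p : X → ℝ) (ρ σ : A → X → Matrix B B ℂ) :
    cqState p (ρ - σ) = cqState p ρ - cqState p σ := by
  ext ⟨x, a, b⟩ ⟨x', a', b'⟩
  simp only [Matrix.sub_apply, cqState_apply]
  split_ifs <;> simp [mul_sub]

theorem cqState_smul (c : ℝ) (p : X → ℝ) (ρ : A → X → Matrix B B ℂ) :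
    cqState p (c • ρ) = c • cqState p ρ := by
  simp [cqState, kronecker_smul, smul_comm c, Finset.smul_sum]

theorem conjTranspose_cqState (p : X → ℝ) (ρ : A → X → Matrix B B ℂ) :
    (cqState p ρ)ᴴ = cqState p fun a x => (ρ a x)ᴴ := by
  simp [cqState, conjTranspose_sum, conjTranspose_kronecker]

theorem cqState_mul [Fintype B] (p q : X → ℝ) (ρ σ : A → X → Matrix B B ℂ) :
    cqState p ρ * cqState q σ = cqState (p * q) (ρ * σ) := by
  ext ⟨x, a, b⟩ ⟨x', a', b'⟩
  simp only [mul_apply, cqState_apply, Fintype.sum_prod_type]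
  rw [Finset.sum_eq_single x (fun y _ hy => by simp [hy.symm]) (by simp),
    Finset.sum_eq_single a (fun y _ hy => by simp [hy.symm]) (by simp)]
  split_ifs <;> simp_all [mul_apply, Finset.mul_sum, mul_mul_mul_comm]

theorem posSemidef_single {n : Type*} [DecidableEq n] (i : n) :
    (single i i (1 : ℂ)).PosSemidef := by
  rw [← diagonal_single]
  exact PosSemidef.diagonal (Pi.single_nonneg.mpr zero_le_one)

theorem posSemidef_cqState [Finite B] (hp : 0 ≤ p) (hρ : ∀ a x, (ρ a x).PosSemidef) :
    (cqState p ρ).PosSemidef :=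
  posSemidef_sum _ fun x _ => posSemidef_sum _ fun a _ =>
    ((posSemidef_single x).kronecker ((posSemidef_single a).kronecker (hρ a x))).smul (hp x)

theorem cqState_mono [Finite B] (hp : 0 ≤ p) (h : ∀ a x, ρ a x ≤ σ a x) :
    cqState p ρ ≤ cqState p σ := by
  rw [le_iff, ← cqState_sub]
  exact posSemidef_cqState hp h

variable [Fintype B]

theorem trace_cqState (p : X → ℝ) (ρ : A → X → Matrix B B ℂ) :
    (cqState p ρ).trace = ∑ x, ∑ a, p x * (ρ a x).trace := by
  simp [cqState, trace_sum, trace_kronecker]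

theorem IsAssemblage.isState_cqState (hρ : IsAssemblage ρ) (hp : p ∈ stdSimplex ℝ X) :
    IsState (cqState p ρ) := by
  refine ⟨posSemidef_cqState hp.1 hρ.posSemidef, ?_⟩
  simp only [trace_cqState, ← Finset.mul_sum, ← trace_sum, (hρ.isState _).2, mul_one]
  exact_mod_cast hp.2

variable [DecidableEq B]

theorem traceNorm_cqState (hp : 0 ≤ p) (M : A → X → Matrix B B ℂ) :
    traceNorm (cqState p M) = ∑ x, ∑ a, p x * traceNorm (M a x) := by
  have habs : CFC.abs (cqState p M) = cqState p fun a x => CFC.abs (M a x) := by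
    refine CFC.sqrt_unique ?_
      (posSemidef_cqState hp fun a x => (CFC.abs_nonneg _).posSemidef).nonneg
    rw [star_eq_conjTranspose, conjTranspose_cqState, cqState_mul, cqState_mul]
    congr 1 with a x : 2
    exact CFC.abs_mul_abs (M a x)
  simp [traceNorm_eq_re_trace_abs, habs, trace_cqState]

end CQState

section LHS

variable {A X B : Type*} [Fintype A] [Fintype B] {ρ : A → X → Matrix B B ℂ}

theorem isState_sum_smul {ι : Type*} [Fintype ι] {p : ι → ℝ} {τ : ι → Matrix B B ℂ}
    (hp : p ∈ stdSimplex ℝ ι) (hτ : ∀ l, IsState (τ l)) : IsState (∑ l, p l • τ l) := by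
  refine ⟨posSemidef_sum _ fun l _ => (hτ l).1.smul (hp.1 l), ?_⟩
  simp only [trace_sum, trace_smul, (hτ _).2, ← Finset.sum_smul, hp.2, one_smul]

theorem exists_isState_smul_eq {ω τ : Matrix B B ℂ} (hω : IsState ω) (hτ : τ.PosSemidef) :
    ∃ τ', IsState τ' ∧ τ.trace.re • τ' = τ := by
  have hre : (τ.trace.re : ℂ) = τ.trace :=
    (Complex.eq_re_of_ofReal_le (r := 0) (by simpa using hτ.trace_nonneg)).symm
  rcases eq_or_ne τ 0 with rfl | h
  · exact ⟨ω, hω, by simp⟩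
  · have htrace : τ.trace.re ≠ 0 := fun h0 =>
      h (hτ.trace_eq_zero_iff.mp (by rw [← hre, h0, Complex.ofReal_zero]))
    refine ⟨τ.trace.re⁻¹ • τ,
      ⟨hτ.smul (inv_nonneg.mpr (Complex.nonneg_iff.mp hτ.trace_nonneg).1), ?_⟩,
      smul_inv_smul₀ htrace τ⟩
    rw [trace_smul, Complex.real_smul, Complex.ofReal_inv, hre, inv_mul_cancel₀]
    rwa [← hre, Complex.ofReal_ne_zero]

theorem IsAssemblage.nonempty_outcome [Nonempty X] (hρ : IsAssemblage ρ) : Nonempty A := by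
  by_contra h
  rw [not_nonempty_iff] at h
  simpa using (hρ.isState (Classical.arbitrary X)).2

variable [Fintype X]

theorem mem_LHS_of_eq_sum {ι : Type*} [Fintype ι] {p : ι → ℝ} {q : A → X → ι → ℝ}
    {τ : ι → Matrix B B ℂ} (hp : p ∈ stdSimplex ℝ ι)
    (hq : ∀ x l, (fun a => q a x l) ∈ stdSimplex ℝ A) (hτ : ∀ l, IsState (τ l))
    (hρ : ∀ a x, ρ a x = ∑ l, (p l * q a x l) • τ l) : ρ ∈ LHS A X B := by
  have hsum : ∀ x, ∑ a, ρ a x = ∑ l, p l • τ l := fun x => by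
    simp only [hρ]
    rw [Finset.sum_comm]
    simp only [← Finset.sum_smul, ← Finset.mul_sum, (hq x _).2, mul_one]
  refine ⟨⟨fun a x => ?_, fun x x' => by rw [hsum, hsum], fun x => ?_⟩, ?_⟩
  · rw [hρ]
    exact posSemidef_sum _ fun l _ => (hτ l).1.smul (mul_nonneg (hp.1 l) ((hq x l).1 a))
  · rw [hsum]
    exact isState_sum_smul hp hτ
  · let e := (Fintype.equivFin ι).symm
    exact ⟨_, p ∘ e, fun a x l => q a x (e l), τ ∘ e,
      ⟨fun l => hp.1 (e l), (e.sum_comp p).trans hp.2⟩, fun x l => hq x (e l), fun l => hτ (e l),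
      fun a x => (hρ a x).trans (e.sum_comp fun l => (p l * q a x l) • τ l).symm⟩

theorem IsState.smul_mem_LHS {τ : Matrix B B ℂ} (hτ : IsState τ) {q : A → X → ℝ}
    (hq : ∀ x, (fun a => q a x) ∈ stdSimplex ℝ A) : (fun a x => q a x • τ) ∈ LHS A X B :=
  mem_LHS_of_eq_sum (ι := Unit) (p := 1) (q := fun a x _ => q a x) (τ := fun _ => τ)
    ⟨fun _ => zero_le_one, by simp⟩ (fun x _ => hq x) (fun _ => hτ) (by simp)

/-- Ensembles of unnormalised quantum states on `ℂ^B`: families of positive semidefinite operators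
of total trace one. The trace of a member is its probability. -/
def ensembles (ι B : Type*) [Fintype ι] [Fintype B] : Set (ι → Matrix B B ℂ) :=
  {τ | (∀ l, (τ l).PosSemidef) ∧ ∑ l, (τ l).trace = 1}

theorem isCompact_ensembles (ι B : Type*) [Fintype ι] [Fintype B] :
    IsCompact (ensembles ι B) := by
  classical
  open scoped Matrix.Norms.L2Operator in
  have : ProperSpace (ι → Matrix B B ℂ) := FiniteDimensional.proper ℂ _
  refine Metric.isCompact_of_isClosed_isBounded ?_ ?_
  · simp only [ensembles, ← nonneg_iff_posSemidef, Set.ofPred_and, Set.ofPred_forall]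
    refine (isClosed_iInter fun l => isClosed_le continuous_const (continuous_apply l)).inter
      (isClosed_eq ?_ continuous_const)
    fun_prop
  · refine (Metric.isBounded_closedBall (x := 0) (r := 1)).subset fun τ hτ => ?_
    rw [mem_closedBall_zero_iff, pi_norm_le_iff_of_nonneg zero_le_one]
    intro l
    calc ‖τ l‖ ≤ (τ l).trace.re := norm_le_re_trace (hτ.1 l)
      _ ≤ ∑ l, (τ l).trace.re := Finset.single_le_sum
          (fun l _ => (Complex.nonneg_iff.mp (hτ.1 l).trace_nonneg).1) (Finset.mem_univ l)
      _ = 1 := by rw [← Complex.re_sum, hτ.2, Complex.one_re]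

variable [DecidableEq A] [DecidableEq X]

/-- The assemblage of the local-hidden-state model whose hidden variable is a deterministic
strategy `f : X → A`, distributed together with the hidden state as in the ensemble `τ`. -/
def deterministicMix (τ : (X → A) → Matrix B B ℂ) (a : A) (x : X) : Matrix B B ℂ :=
  ∑ f, if f x = a then τ f else 0

omit [Fintype B] in
theorem continuous_deterministicMix :
    Continuous (deterministicMix : ((X → A) → Matrix B B ℂ) → A → X → Matrix B B ℂ) := by
  unfold deterministicMix
  refine continuous_pi fun a => continuous_pi fun x => continuous_finsetSum _ fun f _ => ?_
  split_ifs <;> fun_prop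

theorem deterministicMix_mem_LHS {τ : (X → A) → Matrix B B ℂ} (hτ : τ ∈ ensembles (X → A) B) :
    deterministicMix τ ∈ LHS A X B := by
  have hω : IsState (∑ f, τ f) := ⟨posSemidef_sum _ fun f _ => hτ.1 f, by rw [trace_sum, hτ.2]⟩
  choose τ' hτ' hsmul using fun f => exists_isState_smul_eq hω (hτ.1 f)
  refine mem_LHS_of_eq_sum (p := fun f => (τ f).trace.re)
    (q := fun a x f => if f x = a then 1 else 0)
    ⟨fun f => (Complex.nonneg_iff.mp (hτ.1 f).trace_nonneg).1, ?_⟩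
    (fun x f => ⟨fun a => ?_, by simp⟩) hτ' fun a x => ?_
  · rw [← Complex.re_sum, hτ.2, Complex.one_re]
  · dsimp only
    split_ifs <;> simp
  · simp [deterministicMix, ite_smul, hsmul]

theorem sum_ite_prod_eq {q : A → X → ℝ} (hq : ∀ x, ∑ a, q a x = 1) (a : A) (x : X) :
    ∑ f : X → A, (if f x = a then ∏ y, q (f y) y else 0) = q a x := by
  let t : X → Finset A := Function.update (fun _ => Finset.univ) x {a}
  have ht : Fintype.piFinset t = ({f | f x = a} : Finset (X → A)) := by
    ext f
    simp [t, Fintype.mem_piFinset, Function.forall_update_iff _ fun y s => f y ∈ s]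
  calc ∑ f : X → A, (if f x = a then ∏ y, q (f y) y else 0)
      = ∏ y, ∑ b ∈ t y, q b y := by
        rw [← Finset.sum_filter, ← ht, Finset.prod_univ_sum]
    _ = ∑ b ∈ t x, q b x :=
        Fintype.prod_eq_single x fun y hy => by simp [t, Function.update_of_ne hy, hq]
    _ = q a x := by simp [t]

theorem exists_ensemble_deterministicMix_eq (hρ : ρ ∈ LHS A X B) :
    ∃ τ ∈ ensembles (X → A) B, deterministicMix τ = ρ := by
  obtain ⟨-, m, p, q, τ, hp, hq, hτ, hρ⟩ := hρ
  have hprod : ∀ l, ∑ f : X → A, ∏ x, q (f x) x l = 1 := fun l => by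
    rw [← Fintype.prod_sum fun x a => q a x l]
    exact Finset.prod_eq_one fun x _ => (hq x l).2
  refine ⟨fun f => ∑ l, (p l * ∏ x, q (f x) x l) • τ l, ⟨fun f => ?_, ?_⟩, ?_⟩
  · exact posSemidef_sum _ fun l _ => (hτ l).1.smul
      (mul_nonneg (hp.1 l) (Finset.prod_nonneg fun x _ => (hq x l).1 _))
  · simp only [trace_sum, trace_smul, (hτ _).2]
    rw [Finset.sum_comm]
    simp only [← Finset.sum_smul, ← Finset.mul_sum, hprod, mul_one, hp.2, one_smul]
  · ext a x : 2
    have hterm : ∀ f : X → A, (if f x = a then ∑ l, (p l * ∏ y, q (f y) y l) • τ l else 0) =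
        ∑ l, (p l * if f x = a then ∏ y, q (f y) y l else 0) • τ l := fun f => by
      split_ifs <;> simp
    simp only [deterministicMix, hterm]
    rw [Finset.sum_comm, hρ]
    simp only [← Finset.sum_smul, ← Finset.mul_sum,
      sum_ite_prod_eq (q := fun a x => q a x _) fun x => (hq x _).2]

theorem LHS_eq_image_deterministicMix :
    LHS A X B = deterministicMix '' ensembles (X → A) B :=
  Set.Subset.antisymm (fun _ => exists_ensemble_deterministicMix_eq)
    (Set.image_subset_iff.mpr fun _ => deterministicMix_mem_LHS)

end LHS

theorem isCompact_LHS (A X B : Type*) [Fintype A] [Fintype X] [Fintype B] :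
    IsCompact (LHS A X B) := by
  classical
  rw [LHS_eq_image_deterministicMix]
  exact (isCompact_ensembles (X → A) B).image continuous_deterministicMix

section RestrictedRelEntropy

variable {A X B : Type*} [Fintype A] [Fintype X] [Fintype B] {ρ : A → X → Matrix B B ℂ}

theorem IsAssemblage.exists_mem_LHS_le_smul [Nonempty X] (hρ : IsAssemblage ρ) :
    ∃ σ ∈ LHS A X B, ∀ a x, ρ a x ≤ (Fintype.card A : ℝ) • σ a x := by
  have := hρ.nonempty_outcome
  let x₀ := Classical.arbitrary X
  refine ⟨_, (hρ.isState x₀).smul_mem_LHS (q := fun _ _ => (Fintype.card A : ℝ)⁻¹)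
    fun _ => (stdSimplex.barycenter (𝕜 := ℝ) (X := A)).2, fun a x => ?_⟩
  rw [smul_inv_smul₀ (Nat.cast_ne_zero.mpr Fintype.card_ne_zero), hρ.noSignaling x₀ x]
  exact Finset.single_le_sum (fun b _ => (hρ.posSemidef b x).nonneg) (Finset.mem_univ a)

variable [DecidableEq B]

theorem continuous_traceNorm : Continuous (traceNorm : Matrix B B ℂ → ℝ) := by
  open scoped Matrix.Norms.L2Operator in
  have habs : Continuous (CFC.abs : Matrix B B ℂ → Matrix B B ℂ) := CFC.continuous_abs
  simp only [funext traceNorm_eq_re_trace_abs]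
  fun_prop

theorem mem_LHS_of_iInf_traceNorm_nonpos {p : X → ℝ} (hp : ∀ x, 0 < p x)
    (hne : (LHS A X B).Nonempty)
    (h : ⨅ σ : LHS A X B, ∑ x, ∑ a, p x * traceNorm (ρ a x - σ.1 a x) ≤ 0) : ρ ∈ LHS A X B := by
  have hnonneg : ∀ (σ : A → X → Matrix B B ℂ) x a, 0 ≤ p x * traceNorm (ρ a x - σ a x) :=
    fun σ x a => mul_nonneg (hp x).le (traceNorm_nonneg _)
  have hcont : Continuous fun σ : A → X → Matrix B B ℂ =>
      ∑ x, ∑ a, p x * traceNorm (ρ a x - σ a x) := by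
    have := continuous_traceNorm (B := B)
    fun_prop
  obtain ⟨σ, hσ, hmin⟩ := (isCompact_LHS A X B).exists_sInf_image_eq hne hcont.continuousOn
  rw [sInf_image'] at hmin
  suffices ρ = σ from this ▸ hσ
  ext a x : 2
  have hzero : p x * traceNorm (ρ a x - σ a x) ≤ 0 :=
    (Finset.single_le_sum (fun b _ => hnonneg σ x b) (Finset.mem_univ a)).trans <|
      (Finset.single_le_sum (fun y _ => Finset.sum_nonneg fun b _ => hnonneg σ y b)
        (Finset.mem_univ x)).trans (hmin.symm.trans_le h)
  open scoped Matrix.Norms.L2Operator in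
  exact sub_eq_zero.mp <| norm_le_zero_iff.mp <|
    (norm_le_traceNorm _).trans (nonpos_of_mul_nonpos_right hzero (hp x))

variable [DecidableEq A] [DecidableEq X]

theorem iInf_relEntropy_le_restrictedRelEntropy {p : X → ℝ} (hp : p ∈ stdSimplex ℝ X)
    (ρ : A → X → Matrix B B ℂ) :
    ⨅ σ ∈ LHS A X B, relEntropy (cqState p ρ) (cqState p σ) ≤ restrictedRelEntropy ρ :=
  le_iSup₂ (f := fun p (_ : p ∈ stdSimplex ℝ X) =>
    ⨅ σ ∈ LHS A X B, relEntropy (cqState p ρ) (cqState p σ)) p hp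

namespace IsAssemblage

theorem restrictedRelEntropy_nonneg [Nonempty X] (hρ : IsAssemblage ρ) :
    0 ≤ restrictedRelEntropy ρ :=
  have hp := (stdSimplex.barycenter (𝕜 := ℝ) (X := X)).2
  (le_iInf₂ fun _ hσ =>
    relEntropy_nonneg (hρ.isState_cqState hp) (hσ.1.isState_cqState hp)).trans
    (iInf_relEntropy_le_restrictedRelEntropy hp ρ)

theorem restrictedRelEntropy_le [Nonempty X] (hρ : IsAssemblage ρ) :
    restrictedRelEntropy ρ ≤
      ((Fintype.card A * Fintype.card (X × A × B) / Real.log 2 : ℝ) : EReal) := by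
  obtain ⟨σ, hσ, hle⟩ := hρ.exists_mem_LHS_le_smul
  refine iSup₂_le fun p hp => (iInf₂_le σ hσ).trans ?_
  refine relEntropy_le_of_le_smul (hρ.isState_cqState hp) (hσ.1.isState_cqState hp)
    (Nat.cast_nonneg _) ?_
  rw [← cqState_smul]
  exact cqState_mono hp.1 hle

theorem exists_restrictedRelEntropy_eq_coe [Nonempty X] (hρ : IsAssemblage ρ) :
    ∃ r : ℝ, 0 ≤ r ∧ restrictedRelEntropy ρ = (r : EReal) :=
  have hnonneg := hρ.restrictedRelEntropy_nonneg
  ⟨(restrictedRelEntropy ρ).toReal, EReal.toReal_nonneg hnonneg,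
    (EReal.coe_toReal (ne_top_of_le_ne_top (EReal.coe_ne_top _) hρ.restrictedRelEntropy_le)
      (ne_bot_of_le_ne_bot EReal.zero_ne_bot hnonneg)).symm⟩

theorem iInf_traceNorm_le_sqrt (hρ : IsAssemblage ρ) {p : X → ℝ} (hp : p ∈ stdSimplex ℝ X)
    {r : ℝ} (hr : restrictedRelEntropy ρ ≤ r) :
    ⨅ σ : LHS A X B, ∑ x, ∑ a, p x * traceNorm (ρ a x - σ.1 a x) ≤
      Real.sqrt (2 * Real.log 2 * r) := by
  have := Real.log_pos one_lt_two
  have hnonneg : ∀ σ : LHS A X B, 0 ≤ ∑ x, ∑ a, p x * traceNorm (ρ a x - σ.1 a x) := fun σ =>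
    Finset.sum_nonneg fun x _ => Finset.sum_nonneg fun a _ =>
      mul_nonneg (hp.1 x) (traceNorm_nonneg _)
  set I := ⨅ σ : LHS A X B, ∑ x, ∑ a, p x * traceNorm (ρ a x - σ.1 a x)
  have hpinsker : ∀ σ ∈ LHS A X B, ((I ^ 2 / (2 * Real.log 2) : ℝ) : EReal) ≤
      relEntropy (cqState p ρ) (cqState p σ) := fun σ hσ => by
    have hI : I ≤ traceNorm (cqState p ρ - cqState p σ) := by
      rw [← cqState_sub, traceNorm_cqState hp.1]
      exact ciInf_le ⟨0, Set.forall_mem_range.mpr hnonneg⟩ (⟨σ, hσ⟩ : LHS A X B)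
    have hI₀ : 0 ≤ I := Real.iInf_nonneg hnonneg
    refine le_trans ?_ (sq_traceNorm_sub_le_relEntropy (hρ.isState_cqState hp)
      (hσ.1.isState_cqState hp))
    rw [EReal.coe_le_coe_iff]
    gcongr
  have hle : I ^ 2 / (2 * Real.log 2) ≤ r := EReal.coe_le_coe_iff.mp <|
    (le_iInf₂ hpinsker).trans <| (iInf_relEntropy_le_restrictedRelEntropy hp ρ).trans hr
  rw [div_le_iff₀' (by positivity)] at hle
  exact Real.le_sqrt_of_sq_le hle

end IsAssemblage

end RestrictedRelEntropy

end Steering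

theorem mainTheorem11 {A X B : Type*} [Fintype A] [DecidableEq A] [Fintype X] [DecidableEq X]
    [Nonempty X] [Fintype B] [DecidableEq B]
    (ρ : A → X → Matrix B B ℂ) (hρ : Steering.IsAssemblage ρ) :
    (∃ r : ℝ, 0 ≤ r ∧ Steering.restrictedRelEntropy ρ = (r : EReal) ∧
      (⨅ σ : Steering.LHS A X B,
        1 / (Fintype.card X : ℝ) * ∑ x, ∑ a, Steering.traceNorm (ρ a x - σ.1 a x))
        ≤ Real.sqrt (2 * Real.log 2 * r)) ∧
    (Steering.restrictedRelEntropy ρ = 0 → ρ ∈ Steering.LHS A X B) := by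
  have hfactor : ∀ σ : Steering.LHS A X B,
      1 / (Fintype.card X : ℝ) * ∑ x, ∑ a, Steering.traceNorm (ρ a x - σ.1 a x) =
        ∑ x, ∑ a, (Fintype.card X : ℝ)⁻¹ * Steering.traceNorm (ρ a x - σ.1 a x) := fun σ => by
    simp only [one_div, Finset.mul_sum]
  have hbound := fun r : ℝ =>
    hρ.iInf_traceNorm_le_sqrt (stdSimplex.barycenter (𝕜 := ℝ) (X := X)).2 (r := r)
  simp only [hfactor]
  refine ⟨?_, fun hzero => ?_⟩
  · obtain ⟨r, hr₀, hr⟩ := hρ.exists_restrictedRelEntropy_eq_coe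
    exact ⟨r, hr₀, hr, hbound r hr.le⟩
  · obtain ⟨σ, hσ, -⟩ := hρ.exists_mem_LHS_le_smul
    exact Steering.mem_LHS_of_iInf_traceNorm_nonpos
      (fun _ => inv_pos.mpr (Nat.cast_pos.mpr Fintype.card_pos)) ⟨σ, hσ⟩
      (by simpa using hbound 0 (by simp [hzero]))
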